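/- Let $[\pm1]=[-1,1]$. A database is a matrix $D\in\{\pm1\}^{n\times d}$ with rows $D_1,\dots,D_n$, and its one-way marginals are $\overline D=\frac1n\sum_{i=1}^n D_i\in[\pm1]^d$. A randomized mechanism $M:\{\pm1\}^{n\times d}\to[\pm1]^d$ is $(\varepsilon,\delta)$-differentially private if $\Pr[M(D)\in S]\le e^{\varepsilon}\Pr[M(D')\in S]+\delta$ for all databases $D,D'$ that differ only in a single row and all measurable $S\subseteq[\pm1]^d$. (1) For all constants $c,\gamma>0$ there are $K>0$ and $n_0$, depending only on $c$ and $\gamma$, such that the following holds for all $n\ge n_0$, all $d$, and all $\delta$ with $2^{-cn}\le\delta\le 1/n^{1+\gamma}$. If $M:\{\pm1\}^{n\times d}\to[\pm1]^d$ is $(1,\delta)$-differentially private and $\mathbb E_M\|M(D)-\overline D\|_1\le d/10$ for every $D\in\{\pm1\}^{n\times d}$, then $$d\le K\,\frac{n^2}{\log(1/\delta)}.$$ (2) For all constants $c,\gamma,\varepsilon_0>0$ there are $\kappa>0$ and $n_0$, depending only on $c,\gamma,\varepsilon_0$, such that the following holds for all $n\ge n_0$, all $d$, all $0<\varepsilon\le\varepsilon_0$,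 all $0<\alpha\le 1/10$, and all $\delta$ with $2^{-c\varepsilon\alpha n}\le\delta\le 1/n^{1+\gamma}$. If $M:\{\pm1\}^{n\times d}\to[\pm1]^d$ is $(\varepsilon,\delta)$-differentially private and $\mathbb E_M\|M(D)-\overline D\|_1\le\alpha d$ for every $D\in\{\pm1\}^{n\times d}$, then $$n\ge\kappa\,\frac{\sqrt{d\log(1/\delta)}}{\varepsilon\alpha}.$$ -/

import Mathlib

open MeasureTheory

/-- Databases `D ∈ {±1}^{n × d}`: `D i` is the `i`-th row. The type `ℤˣ` is `{1, -1}`. -/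
abbrev Database (n d : ℕ) : Type := Fin n → Fin d → ℤˣ

/-- The cube `[-1, 1]^d`. -/
abbrev Cube (d : ℕ) : Type := Fin d → Set.Icc (-1 : ℝ) 1

/-- A randomized mechanism on databases, with outputs in `R`: each database is mapped to the
probability distribution of the output. -/
abbrev Mechanism (n d : ℕ) (R : Type*) [MeasurableSpace R] : Type _ :=
  Database n d → ProbabilityMeasure R

/-- Two databases are adjacent if they agree outside a single row. -/
def Adjacent {n d : ℕ} (D D' : Database n d) : Prop :=
  ∃ i : Fin n, ∀ i' : Fin n, i' ≠ i → D i' = D' i'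

/-- `(ε, δ)`-differential privacy. -/
def IsDifferentiallyPrivate {n d : ℕ} {R : Type*} [MeasurableSpace R]
    (M : Mechanism n d R) (ε δ : ℝ) : Prop :=
  ∀ D D' : Database n d, Adjacent D D' → ∀ S : Set R, MeasurableSet S →
    (M D : Measure R).real S ≤ Real.exp ε * (M D' : Measure R).real S + δ

/-- The one-way marginals: the mean of each column. -/
noncomputable def oneWayMarginal {n d : ℕ} (D : Database n d) (j : Fin d) : ℝ :=
  (1 / (n : ℝ)) * ∑ i : Fin n, ((D i j : ℤ) : ℝ)

/-- The expected `L₁` error of `M` on the database `D` (the integrand is continuous and bounded). -/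
noncomputable def expectedL1Error {n d : ℕ} (M : Mechanism n d (Cube d)) (D : Database n d) : ℝ :=
  ∫ y : Cube d, ∑ j : Fin d, |(y j : ℝ) - oneWayMarginal D j| ∂(M D : Measure (Cube d))

/-
Draw the columns of a database independently, each with a uniformly random bias in `[-1, 1]`. Given
the other entries of its column, the expected value of an entry is its `predictedMean`, and the
fingerprinting `score` of a row is the correlation of the answer with the entries of that row minus
their predicted means. If the answer does not depend on a row, the score of that row is sub-Gaussian
with variance proxy `d`, so by privacy each of the `m` scores exceeds a small multiple of `d / m`
with probability at most `e^ε exp(-Ω(d / m²)) + δ`. If the answer is accurate, the scores add up to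
a constant times `d` in expectation, so this probability is `Ω(1 / m)`.

For a general `ε` and accuracy `α`, run the mechanism on databases of `m` distinct rows, each
repeated `k` times, with rows of ones as padding. Padding allows `m k` to be as small as `O(α n)`,
and group privacy allows `k` to be as large as a small multiple of `log (1 / δ) / ε`, since then
`n e^{k ε} δ` is still small. Hence `m = O(ε α n / log (1 / δ))`.
-/
open Finset Function ProbabilityTheory

section Column

variable {ι : Type*} [Fintype ι]

lemma abs_units_cast (u : ℤˣ) : |((u : ℤ) : ℝ)| = 1 := by
  rcases Int.units_eq_one_or u with rfl | rfl <;> simp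

/-- The sum of a column of signs. -/
def columnSum (x : ι → ℤˣ) : ℝ := ∑ i, ((x i : ℤ) : ℝ)

/-- The number of entries `1` of a column of signs. -/
def countOnes (x : ι → ℤˣ) : ℕ := #{i | x i = 1}

/-- The probability of a column whose entries are drawn independently with a common mean that is
itself uniform on `[-1, 1]`: the Beta integral `∫ p ^ s * (1 - p) ^ (N - s)` over `[0, 1]`. -/
noncomputable def columnProb (x : ι → ℤˣ) : ℝ :=
  1 / ((Fintype.card ι + 1) * (Fintype.card ι).choose (countOnes x))

lemma columnSum_eq_countOnes (x : ι → ℤˣ) : columnSum x = 2 * countOnes x - Fintype.card ι := by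
  have h (i : ι) : ((x i : ℤ) : ℝ) = 2 * (if x i = 1 then 1 else 0) - 1 := by
    rcases Int.units_eq_one_or (x i) with h | h <;> norm_num [h]
  simp only [columnSum, h, sum_sub_distrib, ← mul_sum]
  simp [countOnes]

lemma countOnes_le_card (x : ι → ℤˣ) : countOnes x ≤ Fintype.card ι := card_le_univ _

lemma columnProb_nonneg (x : ι → ℤˣ) : 0 ≤ columnProb x := by
  unfold columnProb; positivity

lemma abs_columnSum_le (x : ι → ℤˣ) : |columnSum x| ≤ Fintype.card ι := by
  simpa [columnSum, abs_units_cast] using abs_sum_le_sum_abs (fun i => ((x i : ℤ) : ℝ)) univ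

lemma sum_columnProb_mul_countOnes [DecidableEq ι] (g : ℕ → ℝ) :
    ∑ x : ι → ℤˣ, columnProb x * g (countOnes x) =
      (∑ s ∈ range (Fintype.card ι + 1), g s) / (Fintype.card ι + 1) := by
  set N := Fintype.card ι with hN
  calc ∑ x : ι → ℤˣ, columnProb x * g (countOnes x)
      = ∑ A ∈ (univ : Finset ι).powerset, 1 / ((N + 1) * N.choose #A : ℝ) * g #A :=
        sum_nbij' (fun x => ({i | x i = 1} : Finset ι)) (fun A i => if i ∈ A then 1 else -1)
          (by simp) (by simp)
          (fun x _ => funext fun i => by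
            rcases Int.units_eq_one_or (x i) with h | h <;> simp [h])
          (fun A _ => by ext i; by_cases h : i ∈ A <;> simp [h])
          (fun x _ => rfl)
    _ = ∑ s ∈ range (N + 1), g s / (N + 1) := by
        rw [sum_powerset_apply_card fun s => 1 / ((N + 1) * N.choose s : ℝ) * g s, card_univ, ← hN]
        refine sum_congr rfl fun s hs => ?_
        have : (N.choose s : ℝ) ≠ 0 :=
          mod_cast (Nat.choose_pos (mem_range_succ_iff.1 hs)).ne'
        simp only [nsmul_eq_mul]
        field_simp
    _ = _ := (sum_div ..).symm

lemma sum_columnProb [DecidableEq ι] : ∑ x : ι → ℤˣ, columnProb x = 1 := by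
  have h := sum_columnProb_mul_countOnes (ι := ι) fun _ => 1
  simp only [mul_one, sum_const, card_range, nsmul_eq_mul, Nat.cast_add, Nat.cast_one] at h
  rw [h, div_self (by positivity)]

lemma sum_range_two_mul_sub_sq (a : ℝ) (N : ℕ) :
    ∑ s ∈ range (N + 1), (2 * s - a) ^ 2 =
      (N + 1) * (2 * N * (2 * N + 1) / 3 - 2 * a * N + a ^ 2) := by
  induction N with
  | zero => simp
  | succ N ih => rw [sum_range_succ, ih]; push_cast; ring

lemma sum_columnProb_mul_columnSum_sq [DecidableEq ι] :
    ∑ x : ι → ℤˣ, columnProb x * columnSum x ^ 2 =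
      Fintype.card ι * (Fintype.card ι + 2) / 3 := by
  simp_rw [columnSum_eq_countOnes]
  rw [sum_columnProb_mul_countOnes fun s => (2 * s - Fintype.card ι : ℝ) ^ 2,
    sum_range_two_mul_sub_sq]
  field_simp
  ring

/-- The conditional mean under `columnProb` of the `i`-th entry of a column given the others. -/
noncomputable def predictedMean (x : ι → ℤˣ) (i : ι) : ℝ :=
  (columnSum x - (x i : ℤ)) / (Fintype.card ι + 1)

lemma abs_predictedMean_le_one (x : ι → ℤˣ) (i : ι) : |predictedMean x i| ≤ 1 := by
  rw [predictedMean, abs_div, abs_of_pos (by positivity : (0 : ℝ) < Fintype.card ι + 1),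
    div_le_one (by positivity)]
  exact (abs_sub _ _).trans (add_le_add (abs_columnSum_le x) (abs_units_cast _).le)

lemma sum_sub_predictedMean (x : ι → ℤˣ) :
    ∑ i, (((x i : ℤ) : ℝ) - predictedMean x i) = 2 / (Fintype.card ι + 1) * columnSum x := by
  have hsum : ∑ i, ((x i : ℤ) : ℝ) = columnSum x := rfl
  simp only [predictedMean, sum_sub_distrib, ← sum_div, sum_const, card_univ, nsmul_eq_mul, hsum]
  field_simp
  ring

variable [DecidableEq ι]

lemma columnSum_update_sub (x : ι → ℤˣ) (i : ι) (b : ℤˣ) :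
    columnSum (update x i b) - (b : ℤ) = columnSum x - (x i : ℤ) := by
  have h (z : ι → ℤˣ) : columnSum z - (z i : ℤ) = ∑ i' ∈ univ.erase i, ((z i' : ℤ) : ℝ) :=
    (sum_erase_eq_sub (mem_univ i)).symm
  rw [h x, ← sum_congr rfl fun i' hi' => by rw [← update_of_ne (ne_of_mem_erase hi') b x], ← h,
    update_self]

@[simp]
lemma predictedMean_update (x : ι → ℤˣ) (i : ι) (b : ℤˣ) :
    predictedMean (update x i b) i = predictedMean x i := by
  rw [predictedMean, update_self, columnSum_update_sub, predictedMean]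

lemma countOnes_update_one (x : ι → ℤˣ) (i : ι) :
    countOnes (update x i 1) = countOnes (update x i (-1)) + 1 := by
  have h := (columnSum_update_sub x i 1).trans (columnSum_update_sub x i (-1)).symm
  rw [columnSum_eq_countOnes, columnSum_eq_countOnes] at h
  push_cast at h
  have : (countOnes (update x i 1) : ℝ) = countOnes (update x i (-1)) + 1 := by linarith
  exact_mod_cast this

lemma columnProb_update_mul_one_sub (x : ι → ℤˣ) (i : ι) :
    columnProb (update x i 1) * (1 - predictedMean x i) =
      columnProb (update x i (-1)) * (1 + predictedMean x i) := by
  have hle := countOnes_update_one x i ▸ countOnes_le_card (update x i 1)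
  rw [columnProb, columnProb, predictedMean, ← columnSum_update_sub x i (-1),
    columnSum_eq_countOnes, countOnes_update_one]
  set N := Fintype.card ι
  set s := countOnes (update x i (-1))
  have hchoose : (N.choose (s + 1) : ℝ) * (s + 1) = N.choose s * (N - s) := by
    rw [← Nat.cast_sub (by lia)]
    exact_mod_cast Nat.choose_succ_right_eq N s
  have hs : (N.choose s : ℝ) ≠ 0 := mod_cast (Nat.choose_pos (by lia)).ne'
  have hs' : (N.choose (s + 1) : ℝ) ≠ 0 := mod_cast (Nat.choose_pos hle).ne'
  push_cast
  field_simp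
  linear_combination -2 * hchoose

lemma two_point_exp_le {μ : ℝ} (hμ : |μ| ≤ 1) (s : ℝ) :
    (1 + μ) / 2 * Real.exp (s * (1 - μ)) + (1 - μ) / 2 * Real.exp (s * (-1 - μ)) ≤
      Real.exp (s ^ 2 / 2) := by
  obtain ⟨hμ₁, hμ₂⟩ := abs_le.1 hμ
  let p : unitInterval := ⟨(1 + μ) / 2, by linarith, by linarith⟩
  have hp : 1 - (1 + μ) / 2 = (1 - μ) / 2 := by ring
  have hmean : ∫ x, x ∂(bernoulliMeasure 1 (-1) p) = μ := by
    simp only [integral_bernoulliMeasure, p, smul_eq_mul]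
    ring
  have hsupp : ∀ᵐ x ∂(bernoulliMeasure (1 : ℝ) (-1) p), x ∈ Set.Icc (-1 : ℝ) 1 := by
    rw [bernoulliMeasure_def, ae_add_measure_iff]
    exact ⟨Measure.ae_smul_measure (by simp) _, Measure.ae_smul_measure (by simp) _⟩
  have h := (hasSubgaussianMGF_of_mem_Icc aemeasurable_id hsupp).mgf_le s
  simp only [mgf, id, hmean, integral_bernoulliMeasure, p, hp, smul_eq_mul] at h
  have hwidth : (‖(1 : ℝ) - -1‖₊ / 2) ^ 2 = 1 := by norm_num
  rwa [hwidth, NNReal.coe_one, one_mul] at h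

lemma sum_columnProb_update_mul_exp_le (x : ι → ℤˣ) (i : ι) (s : ℝ) :
    ∑ b : ℤˣ, columnProb (update x i b) * Real.exp (s * ((b : ℤ) - predictedMean x i)) ≤
      Real.exp (s ^ 2 / 2) * ∑ b : ℤˣ, columnProb (update x i b) := by
  have hbal := columnProb_update_mul_one_sub x i
  have hexp := two_point_exp_le (abs_predictedMean_le_one x i) s
  set μ := predictedMean x i
  set w : ℤˣ → ℝ := fun b => columnProb (update x i b)
  have hw : 0 ≤ w 1 + w (-1) := add_nonneg (columnProb_nonneg _) (columnProb_nonneg _)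
  have hone : w 1 = (1 + μ) / 2 * (w 1 + w (-1)) := by linear_combination hbal / 2
  have hneg : w (-1) = (1 - μ) / 2 * (w 1 + w (-1)) := by linear_combination -hbal / 2
  rw [UnitsInt.univ, sum_pair (by decide), sum_pair (by decide)]
  push_cast
  calc w 1 * Real.exp (s * (1 - μ)) + w (-1) * Real.exp (s * (-1 - μ))
      = ((1 + μ) / 2 * Real.exp (s * (1 - μ)) + (1 - μ) / 2 * Real.exp (s * (-1 - μ))) *
          (w 1 + w (-1)) := by
        linear_combination Real.exp (s * (1 - μ)) * hone + Real.exp (s * (-1 - μ)) * hneg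
    _ ≤ Real.exp (s ^ 2 / 2) * (w 1 + w (-1)) := by gcongr

end Column

section Prior

variable {m d : ℕ}

/-- The `j`-th column of a database. -/
def column (X : Database m d) (j : Fin d) : Fin m → ℤˣ := fun i => X i j

/-- The probability of a database whose columns are drawn independently from `columnProb`. -/
noncomputable def databaseProb (X : Database m d) : ℝ := ∏ j, columnProb (column X j)

/-- The mean of `F` over a random database with law `databaseProb`. -/
noncomputable def priorMean (F : Database m d → ℝ) : ℝ := ∑ X, databaseProb X * F X

lemma databaseProb_nonneg (X : Database m d) : 0 ≤ databaseProb X :=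
  prod_nonneg fun _ _ => columnProb_nonneg _

lemma column_update (X : Database m d) (i : Fin m) (a : Fin d → ℤˣ) (j : Fin d) :
    column (update X i a) j = update (column X j) i (a j) :=
  funext fun i' => apply_update (fun _ (r : Fin d → ℤˣ) => r j) X i a i'

lemma sum_prod_column (f : Fin d → (Fin m → ℤˣ) → ℝ) :
    ∑ X : Database m d, ∏ j, f j (column X j) = ∏ j, ∑ x, f j x := by
  rw [Fintype.prod_sum]
  exact Fintype.sum_equiv (Equiv.piComm _) _ _ fun _ => rfl

lemma priorMean_column (j : Fin d) (g : (Fin m → ℤˣ) → ℝ) :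
    priorMean (fun X => g (column X j)) = ∑ x, columnProb x * g x := by
  calc priorMean (fun X => g (column X j))
      = ∑ X : Database m d, ∏ j',
          columnProb (column X j') * if j' = j then g (column X j') else 1 :=
        sum_congr rfl fun X _ => by
          simp only [databaseProb, prod_mul_distrib, prod_ite_eq', mem_univ, if_true]
    _ = ∏ j', ∑ x : Fin m → ℤˣ, columnProb x * if j' = j then g x else 1 :=
        sum_prod_column fun j' x => columnProb x * if j' = j then g x else 1
    _ = ∏ j', if j' = j then ∑ x, columnProb x * g x else 1 :=
        prod_congr rfl fun j' _ => by split_ifs <;> simp [sum_columnProb]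
    _ = _ := by simp

lemma sum_databaseProb : ∑ X : Database m d, databaseProb X = 1 := by
  simp [databaseProb, sum_prod_column fun _ => columnProb, sum_columnProb]

lemma priorMean_const (c : ℝ) : priorMean (fun _ : Database m d => c) = c := by
  rw [priorMean, ← sum_mul, sum_databaseProb, one_mul]

lemma priorMean_add (F G : Database m d → ℝ) :
    priorMean (fun X => F X + G X) = priorMean F + priorMean G := by
  simp only [priorMean, mul_add, sum_add_distrib]

lemma priorMean_const_mul (c : ℝ) (F : Database m d → ℝ) :
    priorMean (fun X => c * F X) = c * priorMean F := by
  simp only [priorMean, mul_left_comm, mul_sum]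

lemma priorMean_sum {κ : Type*} (s : Finset κ) (F : κ → Database m d → ℝ) :
    priorMean (fun X => ∑ k ∈ s, F k X) = ∑ k ∈ s, priorMean (F k) := by
  simp only [priorMean, mul_sum]
  exact sum_comm

lemma priorMean_mono {F G : Database m d → ℝ} (h : ∀ X, F X ≤ G X) : priorMean F ≤ priorMean G :=
  sum_le_sum fun X _ => mul_le_mul_of_nonneg_left (h X) (databaseProb_nonneg X)

lemma sum_sum_update {ι β : Type*} [Fintype ι] [DecidableEq ι] [Fintype β] (i : ι)
    (G : (ι → β) → ℝ) :
    ∑ X, ∑ a, G (update X i a) = Fintype.card β * ∑ X, G X := by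
  have hinv : Involutive fun q : (ι → β) × β => (update q.1 i q.2, q.1 i) := fun q => by simp
  let swap : Equiv.Perm ((ι → β) × β) := hinv.toPerm
  calc ∑ X, ∑ a, G (update X i a)
      = ∑ q : (ι → β) × β, G (swap q).1 := by
        simp only [Fintype.sum_prod_type, swap, Involutive.coe_toPerm]
    _ = ∑ q : (ι → β) × β, G q.1 := Equiv.sum_comp swap fun q => G q.1
    _ = Fintype.card β * ∑ X, G X := by simp [Fintype.sum_prod_type, mul_sum]

lemma priorMean_le_of_forall_row (i : Fin m) {F : Database m d → ℝ} {C : ℝ}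
    (h : ∀ X, ∑ a, databaseProb (update X i a) * F (update X i a) ≤
      C * ∑ a, databaseProb (update X i a)) :
    priorMean F ≤ C := by
  have hsum := sum_le_sum fun X (_ : X ∈ univ) => h X
  rw [← mul_sum, sum_sum_update i fun X => databaseProb X * F X, sum_sum_update i databaseProb,
    sum_databaseProb, mul_left_comm, mul_one] at hsum
  exact le_of_mul_le_mul_left hsum (mod_cast Fintype.card_pos)

lemma oneWayMarginal_eq_columnSum_div (X : Database m d) (j : Fin d) :
    oneWayMarginal X j = columnSum (column X j) / m :=
  one_div_mul_eq_div _ _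

lemma abs_oneWayMarginal_le_one (X : Database m d) (j : Fin d) : |oneWayMarginal X j| ≤ 1 := by
  rw [oneWayMarginal_eq_columnSum_div, abs_div, Nat.abs_cast]
  exact div_le_one_of_le₀ (by simpa using abs_columnSum_le (column X j)) (by positivity)

lemma third_le_priorMean_oneWayMarginal_sq (hm : 0 < m) (j : Fin d) :
    1 / 3 ≤ priorMean fun X : Database m d => oneWayMarginal X j ^ 2 := by
  have hm' : (0 : ℝ) < m := by exact_mod_cast hm
  calc (1 / 3 : ℝ) ≤ 1 / m ^ 2 * (m * (m + 2) / 3) := by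
        field_simp
        linarith
    _ = 1 / m ^ 2 * ∑ x : Fin m → ℤˣ, columnProb x * columnSum x ^ 2 := by
        rw [sum_columnProb_mul_columnSum_sq, Fintype.card_fin]
    _ = _ := by
        rw [← priorMean_column j, ← priorMean_const_mul]
        simp only [oneWayMarginal_eq_columnSum_div, div_pow, one_div_mul_eq_div]

end Prior

section Score

variable {m d : ℕ}

/-- The fingerprinting score of row `i`: the correlation of the answer `y` with the part of the row
that the rest of the database does not predict. -/
noncomputable def score (y : Cube d) (X : Database m d) (i : Fin m) : ℝ :=
  ∑ j, (y j : ℝ) * ((X i j : ℤ) - predictedMean (column X j) i)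

lemma abs_cube_le_one (y : Cube d) (j : Fin d) : |(y j : ℝ)| ≤ 1 := abs_le.2 (y j).2

@[fun_prop]
lemma continuous_score (X : Database m d) (i : Fin m) :
    Continuous fun y : Cube d => score y X i := by
  unfold score
  fun_prop

lemma score_le (y : Cube d) (X : Database m d) (i : Fin m) : score y X i ≤ 2 * d := by
  calc score y X i
      ≤ ∑ _j : Fin d, (2 : ℝ) := sum_le_sum fun j _ => by
        refine (le_abs_self _).trans ?_
        rw [abs_mul, ← one_mul (2 : ℝ)]
        gcongr
        · exact abs_cube_le_one y j
        · refine (abs_sub _ _).trans ?_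
          linarith [abs_units_cast (X i j), abs_predictedMean_le_one (column X j) i]
    _ = 2 * d := by simp [mul_comm]

lemma sum_score (y : Cube d) (X : Database m d) :
    ∑ i, score y X i = 2 * m / (m + 1) * ∑ j, (y j : ℝ) * oneWayMarginal X j := by
  rcases Nat.eq_zero_or_pos m with rfl | hm
  · simp
  have : (m : ℝ) ≠ 0 := by exact_mod_cast hm.ne'
  simp only [score]
  rw [sum_comm, mul_sum]
  refine sum_congr rfl fun j _ => ?_
  rw [← mul_sum, show ∑ i, (((X i j : ℤ) : ℝ) - predictedMean (column X j) i) = _ from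
    sum_sub_predictedMean (column X j), oneWayMarginal_eq_columnSum_div, Fintype.card_fin]
  field_simp

lemma sum_databaseProb_update_mul_exp_score_le (y : Cube d) (X : Database m d) (i : Fin m)
    (t : ℝ) :
    ∑ a, databaseProb (update X i a) * Real.exp (t * score y (update X i a) i) ≤
      Real.exp (t ^ 2 * d / 2) * ∑ a, databaseProb (update X i a) := by
  have hentry (j : Fin d) :
      ∑ b : ℤˣ, columnProb (update (column X j) i b) *
          Real.exp (t * y j * ((b : ℤ) - predictedMean (column X j) i)) ≤
        Real.exp (t ^ 2 / 2) * ∑ b : ℤˣ, columnProb (update (column X j) i b) := by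
    refine (sum_columnProb_update_mul_exp_le _ _ _).trans ?_
    refine mul_le_mul_of_nonneg_right (Real.exp_le_exp.2 ?_)
      (sum_nonneg fun b _ => columnProb_nonneg _)
    have hy : (y j : ℝ) ^ 2 ≤ 1 := (sq_le_one_iff_abs_le_one _).2 (abs_cube_le_one y j)
    rw [mul_pow]
    linarith [mul_le_of_le_one_right (sq_nonneg t) hy]
  calc ∑ a, databaseProb (update X i a) * Real.exp (t * score y (update X i a) i)
      = ∑ a : Fin d → ℤˣ, ∏ j, columnProb (update (column X j) i (a j)) *
          Real.exp (t * y j * ((a j : ℤ) - predictedMean (column X j) i)) := by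
        simp only [databaseProb, score, column_update, predictedMean_update, update_self, mul_sum,
          Real.exp_sum, prod_mul_distrib, mul_assoc]
    _ = ∏ j, ∑ b : ℤˣ, columnProb (update (column X j) i b) *
          Real.exp (t * y j * ((b : ℤ) - predictedMean (column X j) i)) :=
        (Fintype.prod_sum fun j b => columnProb (update (column X j) i b) *
          Real.exp (t * y j * ((b : ℤ) - predictedMean (column X j) i))).symm
    _ ≤ ∏ j, Real.exp (t ^ 2 / 2) * ∑ b : ℤˣ, columnProb (update (column X j) i b) :=
        prod_le_prod (fun j _ => sum_nonneg fun b _ =>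
          mul_nonneg (columnProb_nonneg _) (Real.exp_pos _).le) fun j _ => hentry j
    _ = Real.exp (t ^ 2 * d / 2) * ∑ a, databaseProb (update X i a) := by
        rw [prod_mul_distrib, prod_const, card_univ, Fintype.card_fin, ← Real.exp_nat_mul,
          Fintype.prod_sum]
        simp only [databaseProb, column_update]
        ring_nf

end Score

section Fingerprinting

lemma integral_le_add_mul_measureReal_ge {Ω : Type*} [MeasurableSpace Ω] (μ : Measure Ω)
    [IsProbabilityMeasure μ] {Z : Ω → ℝ} (hZ : Measurable Z) (hint : Integrable Z μ) {l B : ℝ}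
    (hl : 0 ≤ l) (hB : ∀ ω, Z ω ≤ B) :
    ∫ ω, Z ω ∂μ ≤ l + B * μ.real {ω | l ≤ Z ω} := by
  have hS : MeasurableSet {ω | l ≤ Z ω} := measurableSet_le measurable_const hZ
  have hind : Integrable ({ω | l ≤ Z ω}.indicator fun _ => B) μ :=
    (integrable_const B).indicator hS
  calc ∫ ω, Z ω ∂μ
      ≤ ∫ ω, (l + {ω | l ≤ Z ω}.indicator (fun _ => B) ω) ∂μ := by
        refine integral_mono hint ((integrable_const l).add hind) fun ω => ?_
        by_cases h : l ≤ Z ω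
        · simpa [h] using (hB ω).trans (le_add_of_nonneg_left hl)
        · simpa [h] using (not_le.1 h).le
    _ = l + B * μ.real {ω | l ≤ Z ω} := by
        rw [integral_add (integrable_const l) hind, integral_indicator_const B hS]
        simp [mul_comm]

lemma integrable_of_compactSpace {Y : Type*} [TopologicalSpace Y] [CompactSpace Y]
    [MeasurableSpace Y] [OpensMeasurableSpace Y] (μ : Measure Y) [IsFiniteMeasure μ] {f : Y → ℝ}
    (hf : Continuous f) : Integrable f μ :=
  hf.integrable_of_hasCompactSupport (HasCompactSupport.of_compactSpace f)

variable {m d : ℕ}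

lemma priorMean_integral_exp_score_le {Q : Mechanism m d (Cube d)} {i : Fin m}
    (hQ : ∀ X a, Q (update X i a) = Q X) (t : ℝ) :
    priorMean (fun X => ∫ y, Real.exp (t * score y X i) ∂(Q X : Measure (Cube d))) ≤
      Real.exp (t ^ 2 * d / 2) := by
  refine priorMean_le_of_forall_row i fun X => ?_
  have hint (a : Fin d → ℤˣ) :
      Integrable (fun y => databaseProb (update X i a) * Real.exp (t * score y (update X i a) i))
        (Q X : Measure (Cube d)) :=
    integrable_of_compactSpace _ (by fun_prop)
  calc ∑ a, databaseProb (update X i a) *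
        ∫ y, Real.exp (t * score y (update X i a) i) ∂(Q (update X i a) : Measure (Cube d))
      = ∫ y, ∑ a, databaseProb (update X i a) * Real.exp (t * score y (update X i a) i)
          ∂(Q X : Measure (Cube d)) := by
        simp only [integral_finsetSum univ fun a _ => hint a, hQ, integral_const_mul]
    _ ≤ ∫ _, Real.exp (t ^ 2 * d / 2) * ∑ a, databaseProb (update X i a)
          ∂(Q X : Measure (Cube d)) :=
        integral_mono (integrable_finsetSum _ fun a _ => hint a) (integrable_const _) fun y =>
          sum_databaseProb_update_mul_exp_score_le y X i t
    _ = _ := by simp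

lemma IsDifferentiallyPrivate.priorMean_score_ge_le {P : Mechanism m d (Cube d)} {ε δ : ℝ}
    (hP : IsDifferentiallyPrivate P ε δ) (i : Fin m) {t : ℝ} (ht : 0 ≤ t) (l : ℝ) :
    priorMean (fun X => (P X : Measure (Cube d)).real {y | l ≤ score y X i}) ≤
      Real.exp ε * (Real.exp (-t * l) * Real.exp (t ^ 2 * d / 2)) + δ := by
  -- Replacing row `i` by a fixed row makes the answer independent of it.
  let Q : Mechanism m d (Cube d) := fun X => P (update X i 1)
  calc priorMean (fun X => (P X : Measure (Cube d)).real {y | l ≤ score y X i})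
      ≤ priorMean fun X => Real.exp ε * (Real.exp (-t * l) *
          ∫ y, Real.exp (t * score y X i) ∂(Q X : Measure (Cube d))) + δ := by
        refine priorMean_mono fun X => ?_
        have hadj : Adjacent X (update X i 1) := ⟨i, fun i' hi' => (update_of_ne hi' _ _).symm⟩
        have hchernoff := measure_ge_le_exp_mul_mgf (μ := (Q X : Measure (Cube d)))
          (X := fun y => score y X i) l ht (integrable_of_compactSpace _ (by fun_prop))
        refine (hP _ _ hadj _ (measurableSet_le (by fun_prop) (by fun_prop))).trans ?_
        gcongr
        exact hchernoff
    _ = Real.exp ε * (Real.exp (-t * l) * priorMean fun X =>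
          ∫ y, Real.exp (t * score y X i) ∂(Q X : Measure (Cube d))) + δ := by
        rw [priorMean_add, priorMean_const_mul, priorMean_const_mul, priorMean_const]
    _ ≤ _ := by
        gcongr
        exact priorMean_integral_exp_score_le (fun X a => by simp only [Q, update_idem]) t

lemma le_integral_sum_score (P : Mechanism m d (Cube d)) (X : Database m d) :
    2 * m / (m + 1) * (∑ j, oneWayMarginal X j ^ 2 - expectedL1Error P X) ≤
      ∫ y, ∑ i, score y X i ∂(P X : Measure (Cube d)) := by
  have hint : Integrable (fun y : Cube d => ∑ j, |(y j : ℝ) - oneWayMarginal X j|)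
      (P X : Measure (Cube d)) := integrable_of_compactSpace _ (by fun_prop)
  have hpoint (y : Cube d) :
      ∑ j, oneWayMarginal X j ^ 2 - ∑ j, |(y j : ℝ) - oneWayMarginal X j| ≤
        ∑ j, (y j : ℝ) * oneWayMarginal X j := by
    rw [← sum_sub_distrib]
    refine sum_le_sum fun j _ => ?_
    have hmul : -|(y j : ℝ) - oneWayMarginal X j| ≤
        ((y j : ℝ) - oneWayMarginal X j) * oneWayMarginal X j := by
      refine neg_le_of_abs_le ?_
      rw [abs_mul]
      exact mul_le_of_le_one_right (abs_nonneg _) (abs_oneWayMarginal_le_one X j)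
    linarith
  calc 2 * m / (m + 1) * (∑ j, oneWayMarginal X j ^ 2 - expectedL1Error P X)
      = ∫ y : Cube d, 2 * m / (m + 1) *
          (∑ j, oneWayMarginal X j ^ 2 - ∑ j, |(y j : ℝ) - oneWayMarginal X j|)
          ∂(P X : Measure (Cube d)) := by
        rw [integral_const_mul, integral_sub (integrable_const _) hint]
        simp [expectedL1Error]
    _ ≤ ∫ y, ∑ i, score y X i ∂(P X : Measure (Cube d)) := by
        refine integral_mono (integrable_of_compactSpace _ (by fun_prop))
          (integrable_of_compactSpace _ (by fun_prop)) fun y => ?_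
        simp only [sum_score]
        gcongr
        exact hpoint y

lemma le_sum_priorMean_integral_score (hm : 0 < m) {P : Mechanism m d (Cube d)} {η : ℝ}
    (hη : ∀ X, expectedL1Error P X ≤ η) :
    2 * m / (m + 1) * (d / 3 - η) ≤
      ∑ i, priorMean fun X => ∫ y, score y X i ∂(P X : Measure (Cube d)) := by
  calc 2 * m / (m + 1) * (d / 3 - η)
      ≤ 2 * m / (m + 1) * (∑ j, priorMean (fun X : Database m d => oneWayMarginal X j ^ 2) +
          -η) := by
        gcongr
        calc (d : ℝ) / 3 + -η = ∑ _j : Fin d, (1 / 3 : ℝ) + -η := by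
              simp [div_eq_mul_inv]
          _ ≤ _ := by
              gcongr with j
              exact third_le_priorMean_oneWayMarginal_sq hm j
    _ = priorMean fun X => 2 * m / (m + 1) * (∑ j, oneWayMarginal X j ^ 2 + -η) := by
        rw [priorMean_const_mul, priorMean_add, priorMean_sum, priorMean_const]
    _ ≤ priorMean fun X => ∑ i, ∫ y, score y X i ∂(P X : Measure (Cube d)) := by
        refine priorMean_mono fun X => ?_
        rw [← integral_finsetSum univ fun i _ => integrable_of_compactSpace _ (by fun_prop)]
        refine le_trans ?_ (le_integral_sum_score P X)
        gcongr
        linarith [hη X]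
    _ = _ := priorMean_sum _ _

theorem fingerprinting_inequality (hm : 0 < m) (hd : 0 < d) {P : Mechanism m d (Cube d)}
    {ε δ : ℝ} (hP : IsDifferentiallyPrivate P ε δ)
    (hacc : ∀ X, expectedL1Error P X ≤ d / 4) :
    1 / 32 ≤ m * (Real.exp (ε - d / (4608 * m ^ 2)) + δ) := by
  have hm' : (1 : ℝ) ≤ m := by exact_mod_cast hm
  have : (0 : ℝ) < d := by exact_mod_cast hd
  set l : ℝ := d / (48 * m) with hl
  have hexp : Real.exp ε * (Real.exp (-(1 / (48 * m)) * l) *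
      Real.exp ((1 / (48 * m)) ^ 2 * d / 2)) = Real.exp (ε - d / (4608 * m ^ 2)) := by
    rw [← Real.exp_add, ← Real.exp_add, hl]
    congr 1
    field_simp
    ring
  have hrow (i : Fin m) :
      priorMean (fun X => ∫ y, score y X i ∂(P X : Measure (Cube d))) ≤
        l + 2 * d * (Real.exp (ε - d / (4608 * m ^ 2)) + δ) := by
    calc priorMean (fun X => ∫ y, score y X i ∂(P X : Measure (Cube d)))
        ≤ priorMean fun X => l + 2 * d * (P X : Measure (Cube d)).real {y | l ≤ score y X i} :=
          priorMean_mono fun X => integral_le_add_mul_measureReal_ge _ (by fun_prop)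
            (integrable_of_compactSpace _ (by fun_prop)) (by positivity)
            fun y => score_le y X i
      _ ≤ _ := by
          rw [priorMean_add, priorMean_const, priorMean_const_mul, ← hexp]
          gcongr
          exact hP.priorMean_score_ge_le i (by positivity) l
  have hlow : (d : ℝ) / 12 ≤ 2 * m / (m + 1) * (d / 3 - d / 4) := by
    rw [div_mul_eq_mul_div, le_div_iff₀ (by positivity)]
    nlinarith
  have hupp := (le_sum_priorMean_integral_score hm hacc).trans
    (sum_le_sum fun i (_ : i ∈ univ) => hrow i)
  simp only [sum_const, card_univ, Fintype.card_fin, nsmul_eq_mul] at hupp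
  have hml : m * l = d / 48 := by
    rw [hl]
    field_simp
  refine le_of_mul_le_mul_left ?_ (by positivity : 0 < 2 * (d : ℝ))
  linarith

end Fingerprinting

section Groups

lemma IsDifferentiallyPrivate.map {n d : ℕ} {R R' : Type*} [MeasurableSpace R]
    [MeasurableSpace R'] {M : Mechanism n d R} {ε δ : ℝ} (hM : IsDifferentiallyPrivate M ε δ)
    {f : R → R'} (hf : Measurable f) :
    IsDifferentiallyPrivate (fun D => (M D).map hf.aemeasurable) ε δ := by
  intro D D' hD S hS
  simp only [ProbabilityMeasure.toMeasure_map, map_measureReal_apply hf hS]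
  exact hM D D' hD _ (hf hS)

lemma IsDifferentiallyPrivate.group {n d : ℕ} {R : Type*} [MeasurableSpace R]
    {M : Mechanism n d R} {ε δ : ℝ} (hM : IsDifferentiallyPrivate M ε δ) (hε : 0 ≤ ε)
    (hδ : 0 ≤ δ) {S : Set R} (hS : MeasurableSet S) {s : Finset (Fin n)} {D D' : Database n d}
    (h : ∀ i ∉ s, D i = D' i) :
    (M D : Measure R).real S ≤
      Real.exp (#s * ε) * (M D' : Measure R).real S + #s * Real.exp (#s * ε) * δ := by
  induction s using Finset.induction_on generalizing D with
  | empty =>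
    obtain rfl : D = D' := funext fun i => h i (notMem_empty i)
    simp
  | insert i s hi ih =>
    have hstep := hM D (update D i (D' i)) ⟨i, fun i' hi' => (update_of_ne hi' _ _).symm⟩ S hS
    have hrest := ih (D := update D i (D' i)) fun i' hi' => by
      rcases eq_or_ne i' i with rfl | hne
      · exact update_self ..
      · rw [update_of_ne hne]
        exact h i' (by simp [hne, hi'])
    have hone : 1 ≤ Real.exp ε * Real.exp (#s * ε) := by
      rw [← Real.exp_add]
      exact Real.one_le_exp (by positivity)
    rw [card_insert_of_notMem hi, Nat.cast_add_one, add_one_mul, add_comm (_ * ε), Real.exp_add]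
    calc (M D : Measure R).real S
        ≤ Real.exp ε * (Real.exp (#s * ε) * (M D' : Measure R).real S +
            #s * Real.exp (#s * ε) * δ) + 1 * δ := by
          rw [one_mul]
          exact hstep.trans (by gcongr)
      _ ≤ Real.exp ε * (Real.exp (#s * ε) * (M D' : Measure R).real S +
            #s * Real.exp (#s * ε) * δ) + Real.exp ε * Real.exp (#s * ε) * δ := by gcongr
      _ = _ := by ring

variable {m n k d : ℕ}

lemma card_filter_div_eq (hk : 0 < k) (hn : m * k ≤ n) (i : Fin m) :
    #{r : Fin n | r.val / k = i} = k := by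
  have hblock : ({r : Fin n | r.val / k = i} : Finset (Fin n)).map Fin.valEmbedding =
      Ico (i * k : ℕ) (i * k + k) := by
    ext r
    have hlt : (i * k + k : ℕ) ≤ n :=
      (Nat.succ_mul i k ▸ Nat.mul_le_mul_right k i.isLt).trans hn
    simp only [mem_map, mem_filter, mem_univ, true_and, Fin.valEmbedding_apply, mem_Ico]
    constructor
    · rintro ⟨a, ha, rfl⟩
      have := (Nat.div_eq_iff hk).1 ha
      omega
    · intro h
      have hdiv : r / k = i := (Nat.div_eq_iff hk).2 (by omega)
      exact ⟨⟨r, by omega⟩, hdiv, rfl⟩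
  simpa using congrArg card hblock

/-- The database of size `n` in which each row of `X` occurs `k` times, filled up by rows of
ones. -/
def replicateRows (n k : ℕ) (X : Database m d) : Database n d := fun r =>
  if h : r.val / k < m then X ⟨r.val / k, h⟩ else 1

lemma IsDifferentiallyPrivate.comp_replicateRows (hk : 0 < k) (hn : m * k ≤ n) {R : Type*}
    [MeasurableSpace R] {M : Mechanism n d R} {ε δ : ℝ} (hM : IsDifferentiallyPrivate M ε δ)
    (hε : 0 ≤ ε) (hδ : 0 ≤ δ) :
    IsDifferentiallyPrivate (fun X : Database m d => M (replicateRows n k X)) (k * ε)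
      (k * Real.exp (k * ε) * δ) := by
  rintro X X' ⟨i, hi⟩ S hS
  have hagree : ∀ r ∉ ({r : Fin n | r.val / k = i} : Finset (Fin n)),
      replicateRows n k X r = replicateRows n k X' r := by
    intro r hr
    simp only [mem_filter, mem_univ, true_and] at hr
    unfold replicateRows
    split_ifs with h
    · exact hi _ (Fin.ne_of_val_ne hr)
    · rfl
  simpa only [card_filter_div_eq hk hn i] using hM.group hε hδ hS hagree

lemma mul_one_sub_oneWayMarginal (X : Database m d) (j : Fin d) :
    m * (1 - oneWayMarginal X j) = ∑ i, (1 - ((X i j : ℤ) : ℝ)) := by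
  rcases Nat.eq_zero_or_pos m with rfl | hm
  · simp
  have : (m : ℝ) ≠ 0 := by exact_mod_cast hm.ne'
  simp only [oneWayMarginal, sum_sub_distrib, sum_const, card_univ, Fintype.card_fin]
  field_simp
  simp

lemma oneWayMarginal_replicateRows (hk : 0 < k) (hn : m * k ≤ n) (X : Database m d)
    (j : Fin d) :
    n * (1 - oneWayMarginal (replicateRows n k X) j) = m * k * (1 - oneWayMarginal X j) := by
  have hrow (r : Fin n) : 1 - ((replicateRows n k X r j : ℤ) : ℝ) =
      ∑ i : Fin m, if r.val / k = i then 1 - ((X i j : ℤ) : ℝ) else 0 := by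
    unfold replicateRows
    split_ifs with h
    · rw [Fintype.sum_eq_single ⟨r.val / k, h⟩ fun i hi =>
        if_neg fun hr => hi (Fin.ext hr.symm), if_pos rfl]
    · rw [sum_eq_zero fun i _ => if_neg fun hr => h (hr.trans_lt i.isLt)]
      simp
  rw [mul_one_sub_oneWayMarginal, mul_right_comm, mul_one_sub_oneWayMarginal, sum_mul,
    sum_congr rfl fun r _ => hrow r, sum_comm]
  refine sum_congr rfl fun i _ => ?_
  rw [← sum_filter, sum_const, card_filter_div_eq hk hn i, nsmul_eq_mul, mul_comm]

/-- The answer `y`, rescaled around `1` by the factor `q` and clipped to the cube: it corrects for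
rows of ones that make up all but a fraction `1 / q` of the database. -/
noncomputable def rescaledAnswer (q : ℝ) (y : Cube d) : Cube d := fun j =>
  Set.projIcc (-1) 1 (by norm_num) (1 + q * (y j - 1))

lemma continuous_rescaledAnswer (q : ℝ) : Continuous (rescaledAnswer q : Cube d → Cube d) :=
  continuous_pi fun j => continuous_projIcc.comp (by fun_prop)

lemma abs_rescaledAnswer_sub_le {q p p' : ℝ} (hq : 0 ≤ q) (hp : p ∈ Set.Icc (-1 : ℝ) 1)
    (hpp' : 1 - p = q * (1 - p')) (y : Cube d) (j : Fin d) :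
    |(rescaledAnswer q y j : ℝ) - p| ≤ q * |(y j : ℝ) - p'| := by
  calc |(rescaledAnswer q y j : ℝ) - p|
      = |(rescaledAnswer q y j : ℝ) - Set.projIcc (-1 : ℝ) 1 (by norm_num) p| := by
        rw [Set.projIcc_of_mem _ hp]
    _ ≤ |1 + q * (y j - 1) - p| := Set.abs_projIcc_sub_projIcc _
    _ = q * |(y j : ℝ) - p'| := by
        rw [← abs_of_nonneg hq, ← abs_mul, abs_of_nonneg hq]
        congr 1
        linear_combination hpp'

/-- The mechanism for databases of `m` rows that runs `M` on `k` copies of each row and corrects the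
answer for the rows filled in. -/
noncomputable def replicatedMechanism (m k : ℕ) (M : Mechanism n d (Cube d)) :
    Mechanism m d (Cube d) := fun X =>
  (M (replicateRows n k X)).map
    (continuous_rescaledAnswer (n / (m * k) : ℝ)).measurable.aemeasurable

lemma expectedL1Error_replicatedMechanism_le (hm : 0 < m) (hk : 0 < k) (hn : m * k ≤ n)
    (M : Mechanism n d (Cube d)) (X : Database m d) :
    expectedL1Error (replicatedMechanism m k M) X ≤
      n / (m * k) * expectedL1Error M (replicateRows n k X) := by
  have : (0 : ℝ) < m := by exact_mod_cast hm
  have : (0 : ℝ) < k := by exact_mod_cast hk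
  have hmarg (j : Fin d) : 1 - oneWayMarginal X j =
      n / (m * k) * (1 - oneWayMarginal (replicateRows n k X) j) := by
    rw [div_mul_eq_mul_div, eq_div_iff (by positivity), oneWayMarginal_replicateRows hk hn,
      mul_comm]
  have hcont := continuous_rescaledAnswer (d := d) (n / (m * k) : ℝ)
  rw [expectedL1Error, expectedL1Error, ← integral_const_mul, replicatedMechanism,
    ProbabilityMeasure.toMeasure_map, integral_map hcont.measurable.aemeasurable
      (Continuous.aestronglyMeasurable (by fun_prop))]
  refine integral_mono (integrable_of_compactSpace _ (by fun_prop))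
    (integrable_of_compactSpace _ (by fun_prop)) fun y => ?_
  simp only [mul_sum]
  exact sum_le_sum fun j _ => abs_rescaledAnswer_sub_le (by positivity)
    (abs_le.1 (abs_oneWayMarginal_le_one X j)) (hmarg j) y j

theorem dimension_le_of_groups (hm : 0 < m) (hk : 0 < k) (hd : 0 < d)
    (hn : m * k ≤ n) {M : Mechanism n d (Cube d)} {ε δ α : ℝ} (hε : 0 ≤ ε) (hδ : 0 < δ)
    (hM : IsDifferentiallyPrivate M ε δ) (hacc : ∀ D, expectedL1Error M D ≤ α * d)
    (hα : 4 * α * n ≤ m * k) (hsmall : 64 * n * Real.exp (k * ε) * δ ≤ 1) :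
    d ≤ 4608 * m ^ 2 * Real.log (1 / δ) := by
  have : (0 : ℝ) < m := by exact_mod_cast hm
  have hk' : (1 : ℝ) ≤ k := by exact_mod_cast hk
  have hn' : (m * k : ℝ) ≤ n := by exact_mod_cast hn
  have hmn : (m : ℝ) ≤ n := (le_mul_of_one_le_right (by positivity) hk').trans hn'
  have herr (X : Database m d) : expectedL1Error (replicatedMechanism m k M) X ≤ d / 4 := by
    calc expectedL1Error (replicatedMechanism m k M) X
        ≤ n / (m * k) * (α * d) := (expectedL1Error_replicatedMechanism_le hm hk hn M X).trans
          (by gcongr; exact hacc _)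
      _ = 4 * α * n / (m * k) * (d / 4) := by ring
      _ ≤ d / 4 := mul_le_of_le_one_left (by positivity) (div_le_one_of_le₀ hα (by positivity))
  have hfing := fingerprinting_inequality hm hd
    ((hM.comp_replicateRows hk hn hε hδ.le).map
      (continuous_rescaledAnswer (n / (m * k) : ℝ)).measurable) herr
  have hgroup : 64 * (m * (k * Real.exp (k * ε) * δ)) ≤ 1 := by
    calc 64 * (m * (k * Real.exp (k * ε) * δ)) = 64 * (m * k) * Real.exp (k * ε) * δ := by ring
      _ ≤ 64 * n * Real.exp (k * ε) * δ := by gcongr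
      _ ≤ 1 := hsmall
  have hexp : Real.exp (d / (4608 * m ^ 2)) ≤ 1 / δ := by
    rw [Real.exp_sub, mul_add, mul_div_assoc'] at hfing
    have hlarge : 1 / 64 ≤ m * Real.exp (k * ε) / Real.exp (d / (4608 * m ^ 2)) := by linarith
    rw [le_div_iff₀ (Real.exp_pos _)] at hlarge
    calc Real.exp (d / (4608 * m ^ 2)) ≤ 64 * m * Real.exp (k * ε) := by linarith
      _ ≤ 64 * n * Real.exp (k * ε) := by gcongr
      _ ≤ 1 / δ := (le_div_iff₀ hδ).2 hsmall
  rw [← Real.le_log_iff_exp_le (by positivity), div_le_iff₀' (by positivity)] at hexp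
  exact hexp

end Groups

section Asymptotics

lemma exists_group_sizes {ε b t : ℝ} (hε : 0 < ε) (hεb : ε ≤ b) (hbt : 2 * b ≤ ε * t) :
    ∃ m k : ℕ, 0 < m ∧ 0 < k ∧ k * ε ≤ 2 * b ∧ 4 * t ≤ m * k ∧ m * k ≤ 5 * t ∧
      m * b ≤ 5 * (ε * t) := by
  have hb : 0 < b := hε.trans_le hεb
  have ht : 0 < t := pos_of_mul_pos_right ((by positivity : 0 < 2 * b).trans_le hbt) hε.le
  set k : ℕ := ⌈b / ε⌉₊
  have hk : 0 < k := Nat.ceil_pos.2 (by positivity)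
  have hk' : (0 : ℝ) < k := by exact_mod_cast hk
  set m : ℕ := ⌈4 * t / k⌉₊
  have hbk : b ≤ k * ε := (div_le_iff₀ hε).1 (Nat.le_ceil _)
  have hkb : k * ε ≤ 2 * b := by
    have h : k * ε < (b / ε + 1) * ε := by gcongr; exact Nat.ceil_lt_add_one (by positivity)
    rw [add_mul, div_mul_cancel₀ _ hε.ne'] at h
    linarith
  have hkt : k ≤ t := le_of_mul_le_mul_right (by linarith : k * ε ≤ t * ε) hε
  have hmk : m * k ≤ 5 * t := by
    have h : m * k < (4 * t / k + 1) * k := by gcongr; exact Nat.ceil_lt_add_one (by positivity)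
    rw [add_mul, div_mul_cancel₀ _ hk'.ne'] at h
    linarith
  refine ⟨m, k, Nat.ceil_pos.2 (by positivity), hk, hkb, (div_le_iff₀ hk').1 (Nat.le_ceil _), hmk,
    ?_⟩
  calc m * b ≤ m * (k * ε) := by gcongr
    _ = m * k * ε := by ring
    _ ≤ 5 * t * ε := by gcongr
    _ = 5 * (ε * t) := by ring

variable {n d : ℕ}

theorem dimension_mul_log_le (hd : 0 < d) {M : Mechanism n d (Cube d)} {ε δ α a : ℝ} (hε : 0 < ε)
    (hδ : 0 < δ) (hα : α ≤ 1 / 5) (hM : IsDifferentiallyPrivate M ε δ)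
    (hacc : ∀ D, expectedL1Error M D ≤ α * d) (hεa : ε ≤ a * Real.log (1 / δ))
    (haα : 2 * (a * Real.log (1 / δ)) ≤ ε * (α * n))
    (hsmall : 64 * n * Real.exp (2 * (a * Real.log (1 / δ))) * δ ≤ 1) :
    d * Real.log (1 / δ) ≤ (340 / a * (ε * α * n)) ^ 2 := by
  obtain ⟨m, k, hm, hk, hkε, hmk, hmk', hma⟩ := exists_group_sizes hε hεa haα
  have hmn : m * k ≤ n := by
    have h : (m * k : ℝ) ≤ n := by
      linarith [mul_le_mul_of_nonneg_right hα (Nat.cast_nonneg n : (0 : ℝ) ≤ n)]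
    exact_mod_cast h
  have hdim : d ≤ 4608 * m ^ 2 * Real.log (1 / δ) :=
    dimension_le_of_groups hm hk hd hmn hε.le hδ hM hacc (by linarith) <|
      le_trans (by gcongr) hsmall
  have hlog : 0 < Real.log (1 / δ) :=
    pos_of_mul_pos_right ((Nat.cast_pos.2 hd).trans_le hdim) (by positivity)
  have ha : 0 < a := pos_of_mul_pos_left (hε.trans_le hεa) hlog.le
  calc d * Real.log (1 / δ)
      ≤ 4608 * m ^ 2 * Real.log (1 / δ) * Real.log (1 / δ) := by gcongr
    _ = 4608 / a ^ 2 * (m * (a * Real.log (1 / δ))) ^ 2 := by field_simp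
    _ ≤ 4608 / a ^ 2 * (5 * (ε * (α * n))) ^ 2 := by gcongr
    _ = 4608 * 5 ^ 2 * (1 / a * (ε * α * n)) ^ 2 := by ring
    _ ≤ 340 ^ 2 * (1 / a * (ε * α * n)) ^ 2 := by gcongr; norm_num
    _ = (340 / a * (ε * α * n)) ^ 2 := by ring

lemma log_one_div_le_of_two_rpow_neg_le {x δ : ℝ} (hx : 0 ≤ x) (hδ : 2 ^ (-x) ≤ δ) :
    Real.log (1 / δ) ≤ x := by
  have h := Real.log_le_log (by positivity) hδ
  rw [Real.log_rpow two_pos] at h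
  rw [one_div, Real.log_inv]
  linarith [mul_le_of_le_one_right hx (by linarith [Real.log_two_lt_d9] : Real.log 2 ≤ 1)]

lemma mul_log_le_log_one_div {x r δ : ℝ} (hx : 0 < x) (hδ₀ : 0 < δ) (hδ : δ ≤ 1 / x ^ r) :
    r * Real.log x ≤ Real.log (1 / δ) := by
  rw [← Real.log_rpow hx]
  exact Real.log_le_log (by positivity) ((le_one_div hδ₀ (by positivity)).1 hδ)

lemma group_privacy_loss_le_one {x γ a δ : ℝ} (hx : 0 < x) (hγ : 0 < γ) (hδ : 0 < δ)
    (ha₀ : 0 < a) (ha : a ≤ γ / (4 * (1 + γ))) (hlog : 3 ≤ a * Real.log (1 / δ))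
    (hxδ : (1 + γ) * Real.log x ≤ Real.log (1 / δ)) :
    64 * x * Real.exp (2 * (a * Real.log (1 / δ))) * δ ≤ 1 := by
  set L := Real.log (1 / δ) with hL
  have hδL : δ = Real.exp (-L) := by
    rw [hL, one_div, Real.log_inv, neg_neg, Real.exp_log hδ]
  have h64 : (64 : ℝ) ≤ Real.exp 6 := by
    calc (64 : ℝ) = (1 + 1) ^ 6 := by norm_num
      _ ≤ Real.exp 1 ^ 6 := by gcongr; exact Real.add_one_le_exp 1
      _ = Real.exp 6 := by rw [← Real.exp_nat_mul]; norm_num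
  have hlogx : Real.log x + 4 * (a * L) ≤ L := by
    have hL₀ : 0 < L := pos_of_mul_pos_right (by linarith : 0 < a * L) ha₀.le
    calc Real.log x + 4 * (a * L) ≤ L / (1 + γ) + 4 * (γ / (4 * (1 + γ)) * L) := by
          gcongr
          exact (le_div_iff₀' (by positivity)).2 hxδ
      _ = L := by field_simp
  calc 64 * x * Real.exp (2 * (a * L)) * δ
      ≤ Real.exp 6 * Real.exp (Real.log x) * Real.exp (2 * (a * L)) * Real.exp (-L) := by
        rw [Real.exp_log hx, ← hδL]
        gcongr
    _ = Real.exp (6 + Real.log x + 2 * (a * L) + -L) := by simp only [Real.exp_add]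
    _ ≤ 1 := Real.exp_le_one_iff.2 (by linarith)

theorem exists_eventually_dimension_mul_log_le {c γ ε₀ : ℝ} (hc : 0 < c) (hγ : 0 < γ) :
    ∃ C : ℝ, 0 < C ∧ ∀ᶠ n : ℕ in Filter.atTop,
      ∀ (d : ℕ) (ε δ α : ℝ) (M : Mechanism n d (Cube d)),
        0 < ε → ε ≤ ε₀ → 0 < α → α ≤ 1 / 5 →
        2 ^ (-(c * (ε * α * n))) ≤ δ → δ ≤ 1 / (n : ℝ) ^ (1 + γ) →
        IsDifferentiallyPrivate M ε δ → (∀ D, expectedL1Error M D ≤ α * d) →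
        0 < Real.log (1 / δ) ∧ d * Real.log (1 / δ) ≤ (C * (ε * α * n)) ^ 2 := by
  set a : ℝ := min (γ / (4 * (1 + γ))) (1 / (2 * c))
  have ha : 0 < a := by positivity
  have hac : 2 * a * c ≤ 1 := by
    linarith [(le_div_iff₀ (by positivity)).1 (min_le_right _ _ : a ≤ 1 / (2 * c))]
  refine ⟨340 / a, by positivity, ?_⟩
  have hlarge : ∀ᶠ n : ℕ in Filter.atTop, max 3 ε₀ / a ≤ Real.log n :=
    (Real.tendsto_log_atTop.comp tendsto_natCast_atTop_atTop).eventually_ge_atTop _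
  filter_upwards [hlarge, Filter.eventually_gt_atTop 0] with n hlogn hn d ε δ α M hε hεε₀ hα hα'
    hδ hδn hM hacc
  have hn' : (0 : ℝ) < n := by exact_mod_cast hn
  have hδ₀ : 0 < δ := lt_of_lt_of_le (by positivity) hδ
  have hLn := mul_log_le_log_one_div hn' hδ₀ hδn
  have hLc := log_one_div_le_of_two_rpow_neg_le (by positivity) hδ
  set L := Real.log (1 / δ)
  have hlogL : Real.log n ≤ L := by
    have : 0 ≤ Real.log n := le_trans (by positivity) hlogn
    nlinarith
  have haL : max 3 ε₀ ≤ a * L := (div_le_iff₀' ha).1 (hlogn.trans hlogL)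
  have hL : 0 < L := pos_of_mul_pos_right ((by positivity : 0 < max 3 ε₀).trans_le haL) ha.le
  refine ⟨hL, ?_⟩
  rcases Nat.eq_zero_or_pos d with rfl | hd
  · rw [Nat.cast_zero, zero_mul]
    positivity
  have haLn : 2 * (a * L) ≤ ε * (α * n) := by
    calc 2 * (a * L) ≤ 2 * (a * (c * (ε * α * n))) := by gcongr
      _ = 2 * a * c * (ε * (α * n)) := by ring
      _ ≤ ε * (α * n) := mul_le_of_le_one_left (by positivity) hac
  exact dimension_mul_log_le hd hε hδ₀ hα' hM hacc (hεε₀.trans ((le_max_right _ _).trans haL)) haLn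
    (group_privacy_loss_le_one hn' hγ hδ₀ ha (min_le_left _ _) ((le_max_left _ _).trans haL) hLn)

end Asymptotics

theorem theorem3p1 :
    (∀ c γ : ℝ, 0 < c → 0 < γ →
      ∃ K : ℝ, 0 < K ∧ ∃ n₀ : ℕ,
        ∀ (n d : ℕ) (δ : ℝ) (M : Mechanism n d (Cube d)),
          n₀ ≤ n →
          (2 : ℝ) ^ (-(c * (n : ℝ))) ≤ δ →
          δ ≤ 1 / (n : ℝ) ^ (1 + γ) →
          IsDifferentiallyPrivate M 1 δ →
          (∀ D : Database n d, expectedL1Error M D ≤ (d : ℝ) / 10) →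
          (d : ℝ) ≤ K * ((n : ℝ) ^ 2 / Real.log (1 / δ))) ∧
    (∀ c γ ε₀ : ℝ, 0 < c → 0 < γ → 0 < ε₀ →
      ∃ κ : ℝ, 0 < κ ∧ ∃ n₀ : ℕ,
        ∀ (n d : ℕ) (ε δ α : ℝ) (M : Mechanism n d (Cube d)),
          n₀ ≤ n →
          0 < ε → ε ≤ ε₀ →
          0 < α → α ≤ 1 / 10 →
          (2 : ℝ) ^ (-(c * (ε * α * (n : ℝ)))) ≤ δ →
          δ ≤ 1 / (n : ℝ) ^ (1 + γ) →
          IsDifferentiallyPrivate M ε δ →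
          (∀ D : Database n d, expectedL1Error M D ≤ α * (d : ℝ)) →
          κ * (Real.sqrt ((d : ℝ) * Real.log (1 / δ)) / (ε * α)) ≤ (n : ℝ)) := by
  constructor
  · intro c γ hc hγ
    obtain ⟨C, hC, hev⟩ := exists_eventually_dimension_mul_log_le (c := 10 * c) (ε₀ := 1)
      (by positivity) hγ
    obtain ⟨n₀, hn₀⟩ := Filter.eventually_atTop.1 hev
    refine ⟨(C / 10) ^ 2, by positivity, n₀, fun n d δ M hn hδ hδn hM hacc => ?_⟩
    obtain ⟨hlog, hdim⟩ := hn₀ n hn d 1 δ (1 / 10) M one_pos le_rfl (by norm_num) (by norm_num)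
      (by convert hδ using 3; ring) hδn hM fun D => (hacc D).trans_eq (by ring)
    rw [mul_div_assoc', le_div_iff₀ hlog]
    exact hdim.trans_eq (by ring)
  · intro c γ ε₀ hc hγ _
    obtain ⟨C, hC, hev⟩ := exists_eventually_dimension_mul_log_le (ε₀ := ε₀) hc hγ
    obtain ⟨n₀, hn₀⟩ := Filter.eventually_atTop.1 hev
    refine ⟨1 / C, by positivity, n₀, fun n d ε δ α M hn hε hεε₀ hα hα' hδ hδn hM hacc => ?_⟩
    have hdim := (hn₀ n hn d ε δ α M hε hεε₀ hα (by linarith) hδ hδn hM hacc).2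
    have hsqrt := (Real.sqrt_le_left (by positivity)).2 hdim
    rw [div_mul_div_comm, one_mul, div_le_iff₀ (by positivity)]
    exact hsqrt.trans_eq (by ring)
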